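/- **Setting.** Let $0<h\le T$, let $X_0\subseteq X\subset\mathbb R^n$ be compact, and let $p\colon X\to\mathbb R$ be continuous. The time domain $\mathbb T$ is $[0,T]$ (continuous time), or $\{0,\Delta t,2\Delta t,\dots,T\}$ where $T$ and $h$ are integer multiples of $\Delta t>0$ (discrete time). Integrals over time are with respect to Lebesgue measure in continuous time; in discrete time $\int_a^b g(t)\,dt$ stands for $\sum\Delta t\,g(t)$ over the grid points $t\in[a,b)$. Let $\mathcal L$ be a linear operator from a linear space $\mathcal C\subseteq C([0,T]\times X)$ to the bounded Borel functions on $[0,T]\times X$. For each $x_0\in X_0$ let $x(t)$, $t\in\mathbb T$, be a jointly measurable $X$-valued stochastic process (the trajectory that belongs to $x_0$), defined on a probability space that may depend on $x_0$. It *follows $\mathcal L$ on $[0,t^*]$* if it solves the martingale problem for $\mathcal L$ up to time $t^*$: for some filtration to which $x$ is adapted and for all $v\in\mathcal C$, $v(t,x(t))-\int_0^t\mathcal Lv(r,x(r))\,dr$, $t\in\mathbb T\cap[0,t^*]$, is a martingale. **Assumption A3.** With $\tau_X=\inf\{t: x(t)\in\partial X\}$, trajectories stop according to the rule $\min(T,\tau_X)$: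 almost surely, $x$ is constant on $[\tau_X,T]\cap\mathbb T$. **Windowed mean problem.** $$P^*=\sup_{t^*,\,x_0^*}\ \mathbb E\Big[\frac1h\int_{t^*-h}^{t^*}p(x(t'))\,dt'\Big],$$ over all $t^*\in[h,T]\cap\mathbb T$ and $x_0^*\in X_0$ such that the trajectory that belongs to $x_0^*$ satisfies $x(0)=x_0^*$ almost surely and follows $\mathcal L$ on $[0,t^*]$. (A trajectory with $\tau_X<t^*$ is thus admitted when $\mathcal L$ is the generator of the stopped process, that is, when remaining at rest is what $\mathcal L$ prescribes at the boundary point where the trajectory was stopped.) **Mean-type measure program.** Let $\Omega_+=\{(s,t)\in[h,T]\times[0,T]: s-h\le t\le s\}$, and let $\Omega_-=\{(s,t)\in[h,T]\times[0,T]: t\le s-h\}$ in continuous time, with $t\le s-h-\Delta t$ instead in discrete time. Let $\varphi(s,x)=(s,s,x)$. The augmented generator $\hat{\mathcal L}$ acts by $(\hat{\mathcal L}v)(s,t,x)=(\mathcal L\,v(s,\cdot,\cdot))(t,x)$ on those $v\in C([h,T]\times[0,T]\times X)$ for which every $v(s,\cdot,\cdot)$ is in $\mathcal C$ and $\hat{\mathcal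 L}v$ is bounded and Borel. Then $$p^*=\sup\ \langle p,\mu_+\rangle/h$$ over all finite nonnegative Borel measures $\mu_0$ on $[h,T]\times X_0$, $\mu_\tau$ on $[h,T]\times X$, $\mu_+$ on $\Omega_+\times X$ and $\mu_-$ on $\Omega_-\times X$ with $$\varphi_\#\mu_\tau=\delta_0\otimes\mu_0+\hat{\mathcal L}^\dagger(\mu_-+\mu_+),\qquad\langle1,\mu_0\rangle=1,\qquad\langle1,\mu_+\rangle=h,$$ where the first equation means $\int v(s,s,x)\,d\mu_\tau=\int v(s,0,x)\,d\mu_0+\int\hat{\mathcal L}v\,d(\mu_-+\mu_+)$ for all $v$ in the domain of $\hat{\mathcal L}$. Suprema are taken in $[-\infty,\infty]$, with $\sup\emptyset=-\infty$. **Theorem.** Under Assumption A3, the measure program is an upper bound on the windowed mean problem: $p^*\ge P^*$. -/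

import Mathlib

open MeasureTheory ProbabilityTheory

namespace WindowRisk

universe u

noncomputable section

/-- Continuous time, or discrete time with increment `Δ`. -/
inductive TimeMode where
  | continuous : TimeMode
  | discrete (Δ : ℝ) : TimeMode

/-- The time increment of a discrete-time system, and `0` in continuous time. -/
def TimeMode.gap : TimeMode → ℝ
  | .continuous => 0
  | .discrete Δ => Δ

/-- Horizon `T`, window length `h` with `0 < h ≤ T`, and the time mode. In discrete time the
increment is positive and `T`, `h` consist of a whole number of steps. -/
structure TimeSetup where
  T : ℝ
  h : ℝ
  mode : TimeMode
  h_pos : 0 < h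
  h_le_T : h ≤ T
  grid : ∀ Δ : ℝ, mode = TimeMode.discrete Δ →
    0 < Δ ∧ (∃ N : ℕ, T = N * Δ) ∧ ∃ m : ℕ, h = m * Δ

namespace TimeSetup

variable (D : TimeSetup)

/-- The interval `[0, T]`. -/
abbrev Horizon : Type := Set.Icc (0 : ℝ) D.T

/-- The interval `[h, T]`, in which the augmentation variable `s` lives. -/
abbrev StopRange : Type := Set.Icc D.h D.T

/-- The time domain: `[0, T]`, or the grid `{k Δ} ∩ [0, T]`. -/
def times : Set D.Horizon :=
  match D.mode with
  | .continuous => Set.univ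
  | .discrete Δ => {t | ∃ k : ℕ, (t : ℝ) = k * Δ}

/-- The time domain as a type. -/
abbrev Time : Type := D.times

/-- The initial time, as a point of `[0, T]`. -/
def zeroH : D.Horizon := ⟨0, le_rfl, D.h_pos.le.trans D.h_le_T⟩

/-- The initial time, as a point of the time domain. -/
def zero : D.Time := ⟨D.zeroH, by
  unfold times
  split
  · trivial
  · exact ⟨0, by simp [zeroH]⟩⟩

/-- The measure that time integration uses: Lebesgue measure on `[0, T]` in continuous time, and
mass `Δ` at each grid point in discrete time. -/
def clock : Measure D.Time :=
  match D.mode with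
  | .continuous => (volume : Measure ℝ).comap (fun t : D.Time => ((t : D.Horizon) : ℝ))
  | .discrete Δ => ENNReal.ofReal Δ • Measure.count

/-- The window `[t - h, t)`. In discrete time it holds the `h / Δ` grid points
`t - h, …, t - Δ`; in continuous time leaving out the end point does not matter. -/
def window (t : D.Time) : Set D.Time :=
  {r | ((t : D.Horizon) : ℝ) - D.h ≤ ((r : D.Horizon) : ℝ) ∧ r < t}

/-- A point of `[h, T]` as a point of `[0, T]`. -/
def stopToHorizon (s : D.StopRange) : D.Horizon := ⟨s, D.h_pos.le.trans s.2.1, s.2.2⟩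

/-- The pairs `(s, t)` with `t ∈ [s - h, s]`. -/
def OmegaPlus : Set (D.StopRange × D.Horizon) :=
  {q | (q.1 : ℝ) - D.h ≤ (q.2 : ℝ) ∧ (q.2 : ℝ) ≤ (q.1 : ℝ)}

/-- The pairs `(s, t)` with `t ∈ [0, s - h]` (continuous time) or `t ∈ [0, s - h - Δ]`
(discrete time). -/
def OmegaMinus : Set (D.StopRange × D.Horizon) :=
  {q | (q.2 : ℝ) ≤ (q.1 : ℝ) - D.h - D.mode.gap}

end TimeSetup

variable {n : ℕ} (D : TimeSetup) (X : Set (EuclideanSpace ℝ (Fin n)))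

/-- A linear operator `v ↦ 𝓛 v` whose domain is a linear space of continuous functions on
`[0, T] × X` and whose values are bounded Borel functions. -/
structure Generator where
  dom : Submodule ℝ C(D.Horizon × X, ℝ)
  op : dom →ₗ[ℝ] (D.Horizon × X → ℝ)
  measurable_op : ∀ v, Measurable (op v)
  bounded_op : ∀ v, ∃ C : ℝ, ∀ z, |op v z| ≤ C

/-- A measurable stochastic process on a probability space, with values in `X`. -/
structure RandomPath where
  Ω : Type u
  [mΩ : MeasurableSpace Ω]
  P : Measure Ω
  [prob : IsProbabilityMeasure P]
  path : D.Time → Ω → X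
  measurable_path : Measurable (Function.uncurry path)

attribute [instance] RandomPath.mΩ RandomPath.prob

variable {D X}

namespace RandomPath

variable (Y : RandomPath.{u} D X)

/-- `τ_X = inf {t : x(t) ∈ ∂X}`, equal to `⊤` on trajectories that never meet the boundary. -/
def exitTime (ω : Y.Ω) : EReal :=
  sInf {a : EReal | ∃ t : D.Time,
    ((Y.path t ω : X) : EuclideanSpace ℝ (Fin n)) ∈ frontier X ∧
      a = (((t : D.Horizon) : ℝ) : EReal)}

/-- Trajectories stop according to the rule `min (T, τ_X)`: almost surely the trajectory, which is
defined up to time `T` only, stays at rest from time `τ_X` on. -/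
def StopsAtExit : Prop :=
  ∀ᵐ ω ∂Y.P, ∀ r t : D.Time, Y.exitTime ω ≤ (((r : D.Horizon) : ℝ) : EReal) → r ≤ t →
    Y.path t ω = Y.path r ω

/-- `v(t, x(t)) - ∫_0^t 𝓛 v(r, x(r)) dr`; in discrete time the integral is
`∑ Δ 𝓛 v(k Δ, x(k Δ))` over the grid points `k Δ < t`. -/
def dynkin (L : Generator D X) (v : L.dom) (t : D.Time) (ω : Y.Ω) : ℝ :=
  (v : C(D.Horizon × X, ℝ)) ((t : D.Horizon), Y.path t ω)
    - ∫ r in Set.Iio t, L.op v ((r : D.Horizon), Y.path r ω) ∂D.clock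

/-- `x(t)` follows `𝓛` on `[0, tstar]`: it solves the martingale problem for `𝓛` up to time
`tstar`, with respect to some filtration to which it is adapted. In discrete time this says
`E[v(t + Δ, x(t + Δ)) | past up to t] = v(t, x(t)) + Δ 𝓛 v(t, x(t))`. -/
def Follows (L : Generator D X) (tstar : D.Time) : Prop :=
  ∃ ℱ : Filtration D.Time Y.mΩ,
    (∀ t, @Measurable Y.Ω X (ℱ t) _ (Y.path t)) ∧
    ∀ v : L.dom, Martingale (fun t => Y.dynkin L v (min t tstar)) ℱ Y.P

/-- The random variable `(1 / h) ∫_{t - h}^{t} p(x(t')) dt'`; in discrete time, the average of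
`p(x(t'))` over the `h / Δ` time steps of the window. -/
def windowAverage (p : C(X, ℝ)) (t : D.Time) (ω : Y.Ω) : ℝ :=
  (1 / D.h) * ∫ r in D.window t, p (Y.path r ω) ∂D.clock

end RandomPath

/-- A functional of real random variables on probability spaces. -/
abbrev RiskFunctional :=
  ∀ (Ω : Type u) [MeasurableSpace Ω], Measure Ω → (Ω → ℝ) → EReal

/-- The mean. -/
def meanRisk : RiskFunctional.{u} := fun _ _ P V => ((∫ ω, V ω ∂P : ℝ) : EReal)

/-- Feasible points of the time-windowed risk problem: `tstar ∈ [h, T]`, the trajectory that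
belongs to `x₀` starts at `x₀` and follows `𝓛` on `[0, tstar]`. -/
def Feasible {X₀ : Set (EuclideanSpace ℝ (Fin n))} (L : Generator D X)
    (traj : X₀ → RandomPath.{u} D X) (tstar : D.Time) (x₀ : X₀) : Prop :=
  D.h ≤ ((tstar : D.Horizon) : ℝ) ∧
  (∀ᵐ ω ∂(traj x₀).P,
    (((traj x₀).path D.zero ω : X) : EuclideanSpace ℝ (Fin n)) = x₀) ∧
  (traj x₀).Follows L tstar

/-- `P*`, the supremum over feasible `(tstar, x₀)` of the risk of the window average, as an
extended real number (`⊥` if no point is feasible). -/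
def windowRiskValue (R : RiskFunctional.{u}) {X₀ : Set (EuclideanSpace ℝ (Fin n))}
    (L : Generator D X) (traj : X₀ → RandomPath.{u} D X) (p : C(X, ℝ)) : EReal :=
  sSup {a : EReal | ∃ (tstar : D.Time) (x₀ : X₀), Feasible L traj tstar x₀ ∧
    a = R (traj x₀).Ω (traj x₀).P ((traj x₀).windowAverage p tstar)}

/-- The section `(t, x) ↦ v(s, t, x)`. -/
def timeSection (v : C(D.StopRange × D.Horizon × X, ℝ)) (s : D.StopRange) :
    C(D.Horizon × X, ℝ) :=
  ⟨fun z => v (s, z), by fun_prop⟩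

/-- The graph of the augmented generator, for which `s` is constant and `x(t)` follows `𝓛`:
`v` is continuous on `[h, T] × [0, T] × X`, every section `v(s, ·, ·)` lies in the domain of `𝓛`,
and `w(s, ·, ·) = 𝓛 (v(s, ·, ·))` is a bounded Borel function of `(s, t, x)`. -/
def AugGraph (L : Generator D X) (v : C(D.StopRange × D.Horizon × X, ℝ))
    (w : D.StopRange × D.Horizon × X → ℝ) : Prop :=
  (∀ s, ∃ hv : timeSection v s ∈ L.dom, ∀ z, w (s, z) = L.op ⟨timeSection v s, hv⟩ z) ∧
  Measurable w ∧ ∃ C : ℝ, ∀ z, |w z| ≤ C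

/-- The map `φ : (s, x) ↦ (s, s, x)`. -/
def diagMap (D : TimeSetup) (X : Set (EuclideanSpace ℝ (Fin n)))
    (q : D.StopRange × X) : D.StopRange × D.Horizon × X :=
  (q.1, D.stopToHorizon q.1, q.2)

/-- The map `(s, x) ↦ (s, 0, x)`; the image of `μ₀` under it is `δ_{t = 0} ⊗ μ₀`. -/
def initMap (D : TimeSetup) (X : Set (EuclideanSpace ℝ (Fin n)))
    (q : D.StopRange × X) : D.StopRange × D.Horizon × X :=
  (q.1, D.zeroH, q.2)

/-- Feasible points of the mean-type measure program: finite Borel measures `μ₀` on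
`[h, T] × X₀`, `μτ` on `[h, T] × X`, `μp` on `Ω₊ × X`, `μm` on `Ω₋ × X` (the supports are imposed
as null sets in the larger spaces) with
`φ_# μτ = δ₀ ⊗ μ₀ + 𝓛̂† (μm + μp)`, tested against the domain of the augmented generator,
`⟨1, μ₀⟩ = 1` and `⟨1, μp⟩ = h`. -/
structure LPFeasible (X₀ : Set (EuclideanSpace ℝ (Fin n))) (L : Generator D X)
    (μ₀ μτ : Measure (D.StopRange × X)) (μp μm : Measure (D.StopRange × D.Horizon × X)) :
    Prop where
  finite_init : IsFiniteMeasure μ₀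
  finite_term : IsFiniteMeasure μτ
  finite_plus : IsFiniteMeasure μp
  finite_minus : IsFiniteMeasure μm
  supp_init : μ₀ {q | (q.2 : EuclideanSpace ℝ (Fin n)) ∉ X₀} = 0
  supp_plus : μp {q | (q.1, q.2.1) ∉ D.OmegaPlus} = 0
  supp_minus : μm {q | (q.1, q.2.1) ∉ D.OmegaMinus} = 0
  flow : ∀ v w, AugGraph L v w →
    ∫ z, v z ∂(μτ.map (diagMap D X)) = ∫ z, v z ∂(μ₀.map (initMap D X)) + ∫ z, w z ∂(μm + μp)
  mass_init : μ₀ Set.univ = 1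
  mass_plus : μp Set.univ = ENNReal.ofReal D.h

/-- `p*`, the supremum of `⟨p, μp⟩ / h` over the feasible points of the measure program. -/
def meanLPValue (X₀ : Set (EuclideanSpace ℝ (Fin n))) (L : Generator D X) (p : C(X, ℝ)) :
    EReal :=
  sSup {a : EReal | ∃ μ₀ μτ μp μm, LPFeasible X₀ L μ₀ μτ μp μm ∧
    a = (((∫ z, p z.2.2 ∂μp) / D.h : ℝ) : EReal)}

end

end WindowRisk

/-! Every feasible pair `(tstar, x₀)` produces a feasible point of the measure program with the same
objective value, so the supremum over measures is at least as large. The augmentation variable is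
frozen at `s = tstar`: `μ₀` is the Dirac mass at `(s, x₀)`, `μτ` is the law of `(s, x(tstar))`, and
`μp`, `μm` are the occupation measures of the window and of the earlier times. The flow equation is
Dynkin's formula in expectation for the section `v(s, ·, ·)`: a martingale has the same mean at
times `0` and `tstar` (`integral_flow`). The mass and support constraints reduce to `clock_window`
and `mem_OmegaMinus_of_mem_diff`, and Fubini identifies the objectives
(`integral_occupation_window_div`). -/

namespace WindowRisk

/-! ### Time domain, clock and windows -/

namespace TimeSetup

variable (D : TimeSetup)

/-- A time at or after the end of the first window, as a value of the augmentation variable. -/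
def toStopRange (t : D.Time) (ht : D.h ≤ ((t : D.Horizon) : ℝ)) : D.StopRange :=
  ⟨((t : D.Horizon) : ℝ), ht, t.1.2.2⟩

theorem measurable_time_coe : Measurable (fun t : D.Time => ((t : D.Horizon) : ℝ)) :=
  measurable_subtype_coe.comp measurable_subtype_coe

theorem time_coe_injective : Function.Injective (fun t : D.Time => ((t : D.Horizon) : ℝ)) :=
  Subtype.val_injective.comp Subtype.val_injective

theorem zero_le (t : D.Time) : D.zero ≤ t := (t : D.Horizon).2.1

theorem measurableSet_Iio_time (t : D.Time) : MeasurableSet (Set.Iio t) :=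
  D.measurable_time_coe (measurableSet_Iio (a := ((t : D.Horizon) : ℝ)))

theorem measurableSet_window (t : D.Time) : MeasurableSet (D.window t) :=
  (measurableSet_le measurable_const D.measurable_time_coe).inter (D.measurableSet_Iio_time t)

theorem window_subset_Iio (t : D.Time) : D.window t ⊆ Set.Iio t := fun _ hr => hr.2

section Continuous

variable {D} (hm : D.mode = TimeMode.continuous)
include hm

theorem mem_times_of_continuous (t : D.Horizon) : t ∈ D.times := by
  simp [times, hm]

theorem clock_apply_of_continuous (S : Set D.Time) :
    D.clock S = volume ((fun t : D.Time => ((t : D.Horizon) : ℝ)) '' S) := by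
  have hu : D.times = Set.univ := Set.eq_univ_of_forall (mem_times_of_continuous hm)
  have he : MeasurableEmbedding (fun t : D.Time => ((t : D.Horizon) : ℝ)) :=
    (MeasurableEmbedding.subtype_coe measurableSet_Icc).comp
      (MeasurableEmbedding.subtype_coe (hu ▸ MeasurableSet.univ))
  simp only [clock, hm]
  exact he.comap_apply _ _

end Continuous

section Discrete

variable {D} {Δ : ℝ} (hm : D.mode = TimeMode.discrete Δ)
include hm

theorem mem_times_of_discrete {t : D.Horizon} : t ∈ D.times ↔ ∃ k : ℕ, (t : ℝ) = k * Δ := by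
  simp [times, hm]

theorem clock_of_discrete : D.clock = ENNReal.ofReal Δ • Measure.count := by
  simp [clock, hm]

theorem finite_time_of_discrete : Finite D.Time := by
  obtain ⟨hΔ, ⟨N, hN⟩, -⟩ := D.grid Δ hm
  refine Set.finite_univ_iff.1 (Set.Finite.of_finite_image
    (f := fun t : D.Time => ((t : D.Horizon) : ℝ))
    ((Set.finite_range fun k : Fin (N + 1) => (k : ℝ) * Δ).subset ?_)
    D.time_coe_injective.injOn)
  rintro _ ⟨t, -, rfl⟩
  obtain ⟨k, hk⟩ := (mem_times_of_discrete hm).1 t.2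
  have hkN : (k : ℝ) ≤ N := by
    have := (t : D.Horizon).2.2
    rw [hk, hN] at this
    exact le_of_mul_le_mul_right this hΔ
  exact ⟨⟨k, Nat.lt_succ_of_le (by exact_mod_cast hkN)⟩, hk.symm⟩

/-- With `t = k * Δ`, the window corresponds to the indices `k - m ≤ j < k`. Leaving out the end
point makes the count `m` rather than `m + 1`. -/
theorem encard_window_of_discrete {m : ℕ} (hh : D.h = m * Δ) (t : D.Time)
    (ht : D.h ≤ ((t : D.Horizon) : ℝ)) : (D.window t).encard = m := by
  obtain ⟨hΔ, -, -⟩ := D.grid Δ hm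
  obtain ⟨k, hk⟩ := (mem_times_of_discrete hm).1 t.2
  -- Keeps the truncated subtraction `k - m` exact, so the index interval has all `m` elements.
  have hmk : m ≤ k := by
    rw [hh, hk] at ht
    exact_mod_cast le_of_mul_le_mul_right ht hΔ
  have himage : (fun t : D.Time => ((t : D.Horizon) : ℝ)) '' D.window t =
      (fun j : ℕ => (j : ℝ) * Δ) '' Set.Ico (k - m) k := by
    ext a
    constructor
    · rintro ⟨r, ⟨hr₁, hr₂⟩, rfl⟩
      obtain ⟨j, hj⟩ := (mem_times_of_discrete hm).1 r.2
      refine ⟨j, ⟨?_, ?_⟩, hj.symm⟩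
      · rw [hk, hj, hh] at hr₁
        have : (k : ℝ) ≤ j + m := le_of_mul_le_mul_right (by linarith) hΔ
        have : k ≤ j + m := by exact_mod_cast this
        omega
      · have hr : ((r : D.Horizon) : ℝ) < ((t : D.Horizon) : ℝ) := hr₂
        rw [hk, hj] at hr
        exact_mod_cast lt_of_mul_lt_mul_right hr hΔ.le
    · rintro ⟨j, ⟨hj₁, hj₂⟩, rfl⟩
      have hjk : (j : ℝ) * Δ < k * Δ := mul_lt_mul_of_pos_right (by exact_mod_cast hj₂) hΔ
      have hkj : (k : ℝ) * Δ ≤ (j + m) * Δ :=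
        mul_le_mul_of_nonneg_right (by exact_mod_cast (by omega : k ≤ j + m)) hΔ.le
      have hjT : (j : ℝ) * Δ ≤ D.T := by
        have := (t : D.Horizon).2.2
        rw [hk] at this
        linarith
      refine ⟨⟨⟨(j : ℝ) * Δ, by positivity, hjT⟩, (mem_times_of_discrete hm).2 ⟨j, rfl⟩⟩,
        ⟨?_, ?_⟩, rfl⟩
      · simp only [hk, hh]
        linarith
      · change (j : ℝ) * Δ < ((t : D.Horizon) : ℝ)
        rwa [hk]
  have hinj : Function.Injective (fun j : ℕ => (j : ℝ) * Δ) := fun a b hab => by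
    exact_mod_cast mul_right_cancel₀ hΔ.ne' hab
  rw [← D.time_coe_injective.encard_image, himage, hinj.encard_image,
    ← Finset.coe_Ico, Set.encard_coe_eq_coe_finsetCard, Nat.card_Ico, Nat.sub_sub_self hmk]

end Discrete

/-- Finiteness of the clock makes occupation measures finite and bounded Borel functions integrable
along paths. -/
instance isFiniteMeasure_clock : IsFiniteMeasure D.clock := by
  cases hm : D.mode with
  | continuous =>
    refine ⟨?_⟩
    rw [clock_apply_of_continuous hm]
    refine (measure_mono (t := Set.Icc 0 D.T) ?_).trans_lt (by simp)
    rintro _ ⟨t, -, rfl⟩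
    exact (t : D.Horizon).2
  | discrete Δ =>
    have := finite_time_of_discrete hm
    refine ⟨?_⟩
    rw [clock_of_discrete hm, Measure.smul_apply, smul_eq_mul]
    exact ENNReal.mul_lt_top ENNReal.ofReal_lt_top
      (Measure.count_apply_lt_top.2 Set.finite_univ)

theorem clock_window (t : D.Time) (ht : D.h ≤ ((t : D.Horizon) : ℝ)) :
    D.clock (D.window t) = ENNReal.ofReal D.h := by
  cases hm : D.mode with
  | continuous =>
    have himage : (fun t : D.Time => ((t : D.Horizon) : ℝ)) '' D.window t =
        Set.Ico (((t : D.Horizon) : ℝ) - D.h) ((t : D.Horizon) : ℝ) := by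
      ext a
      constructor
      · rintro ⟨r, hr, rfl⟩
        exact hr
      · rintro ⟨ha₁, ha₂⟩
        exact ⟨⟨⟨a, by linarith, ha₂.le.trans (t : D.Horizon).2.2⟩,
          mem_times_of_continuous hm _⟩, ⟨ha₁, ha₂⟩, rfl⟩
    rw [clock_apply_of_continuous hm, himage, Real.volume_Ico, sub_sub_cancel]
  | discrete Δ =>
    obtain ⟨hΔ, -, m, hh⟩ := D.grid Δ hm
    rw [clock_of_discrete hm, Measure.smul_apply, smul_eq_mul,
      Measure.count_apply (D.measurableSet_window t), encard_window_of_discrete hm hh t ht, hh,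
      mul_comm, ENNReal.ofReal_mul (Nat.cast_nonneg m)]
    simp

theorem mem_OmegaPlus_of_mem_window {t r : D.Time} (ht : D.h ≤ ((t : D.Horizon) : ℝ))
    (hr : r ∈ D.window t) : (D.toStopRange t ht, (r : D.Horizon)) ∈ D.OmegaPlus :=
  ⟨hr.1, le_of_lt (show ((r : D.Horizon) : ℝ) < ((t : D.Horizon) : ℝ) from hr.2)⟩

theorem mem_OmegaMinus_of_mem_diff {t r : D.Time} (ht : D.h ≤ ((t : D.Horizon) : ℝ))
    (hr : r ∈ Set.Iio t \ D.window t) :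
    (D.toStopRange t ht, (r : D.Horizon)) ∈ D.OmegaMinus := by
  have hlt : ((r : D.Horizon) : ℝ) < ((t : D.Horizon) : ℝ) - D.h := by
    by_contra! hle
    exact hr.2 ⟨hle, hr.1⟩
  change ((r : D.Horizon) : ℝ) ≤ ((t : D.Horizon) : ℝ) - D.h - D.mode.gap
  cases hm : D.mode with
  | continuous => simpa [TimeMode.gap] using hlt.le
  | discrete Δ =>
    obtain ⟨hΔ, -, m, hh⟩ := D.grid Δ hm
    obtain ⟨k, hk⟩ := (mem_times_of_discrete hm).1 t.2
    obtain ⟨j, hj⟩ := (mem_times_of_discrete hm).1 r.2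
    simp only [TimeMode.gap]
    rw [hj, hk, hh] at hlt ⊢
    have hlt' : (j : ℝ) + m < k := lt_of_mul_lt_mul_right (by linarith) hΔ.le
    -- A grid point strictly before `t - h` precedes it by at least one full step; this is the gap
    -- `Δ` in `OmegaMinus`.
    have hle : (j : ℝ) + m + 1 ≤ k := by exact_mod_cast hlt'
    have := mul_le_mul_of_nonneg_right hle hΔ.le
    linarith

end TimeSetup

variable {n : ℕ} {D : TimeSetup} {X : Set (EuclideanSpace ℝ (Fin n))}

/-! ### Occupation measures and Dynkin's formula -/

namespace RandomPath

variable (Y : RandomPath D X)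

theorem measurable_path_apply (t : D.Time) : Measurable (Y.path t) :=
  Y.measurable_path.comp measurable_prodMk_left

/-- The map `(ω, r) ↦ (s, r, x(r))`. -/
def augPath (s : D.StopRange) (q : Y.Ω × D.Time) : D.StopRange × D.Horizon × X :=
  (s, (q.2 : D.Horizon), Y.path q.2 q.1)

theorem measurable_augPath (s : D.StopRange) : Measurable (Y.augPath s) :=
  measurable_const.prodMk ((measurable_subtype_coe.comp measurable_snd).prodMk
    (Y.measurable_path.comp measurable_swap))

/-- The occupation measure of `(s, r, x(r))` over the times `r` in `S`. -/
noncomputable def occupation (s : D.StopRange) (S : Set D.Time) :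
    Measure (D.StopRange × D.Horizon × X) :=
  (Y.P.prod (D.clock.restrict S)).map (Y.augPath s)

instance isFiniteMeasure_occupation (s : D.StopRange) (S : Set D.Time) :
    IsFiniteMeasure (Y.occupation s S) := by
  unfold occupation
  infer_instance

theorem occupation_univ (s : D.StopRange) (S : Set D.Time) :
    Y.occupation s S Set.univ = D.clock S := by
  rw [occupation, Measure.map_apply (Y.measurable_augPath s) MeasurableSet.univ,
    Set.preimage_univ, ← Set.univ_prod_univ, Measure.prod_prod]
  simp

theorem occupation_null_of_forall_mem (s : D.StopRange) {S : Set D.Time} (hS : MeasurableSet S)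
    {A : Set (D.StopRange × D.Horizon)} (hA : MeasurableSet A)
    (hmem : ∀ r ∈ S, (s, (r : D.Horizon)) ∈ A) :
    Y.occupation s S {q | (q.1, q.2.1) ∉ A} = 0 := by
  have hA' : MeasurableSet {q : D.StopRange × D.Horizon × X | (q.1, q.2.1) ∉ A} :=
    (measurable_fst.prodMk (measurable_fst.comp measurable_snd)) hA.compl
  rw [occupation, Measure.map_apply (Y.measurable_augPath s) hA']
  -- Any violation of `A` happens at a time outside `S`, which the restricted clock does not charge.
  refine measure_mono_null (t := Set.univ ×ˢ Sᶜ) (fun q hq => ⟨trivial, fun h => hq (hmem _ h)⟩) ?_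
  rw [Measure.prod_prod, Measure.restrict_apply hS.compl]
  simp

theorem occupation_add_occupation_diff (s : D.StopRange) {S S' : Set D.Time}
    (hS : MeasurableSet S) (h : S ⊆ S') :
    Y.occupation s (S' \ S) + Y.occupation s S = Y.occupation s S' := by
  rw [occupation, occupation, ← Measure.map_add _ _ (Y.measurable_augPath s), ← Measure.prod_add,
    ← Measure.restrict_union Set.disjoint_sdiff_left hS, Set.sdiff_union_of_subset h, occupation]

theorem integrable_occupation {s : D.StopRange} {S : Set D.Time}
    {w : D.StopRange × D.Horizon × X → ℝ} (hw : Measurable w) {C : ℝ} (hC : ∀ z, |w z| ≤ C) :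
    Integrable (fun q => w (Y.augPath s q)) (Y.P.prod (D.clock.restrict S)) :=
  Integrable.of_bound (hw.comp (Y.measurable_augPath s)).aestronglyMeasurable C
    (Filter.Eventually.of_forall fun _ => hC _)

/-- Fubini with the expectation outermost, to match the time integral inside `dynkin`. -/
theorem integral_occupation {s : D.StopRange} {S : Set D.Time}
    {w : D.StopRange × D.Horizon × X → ℝ} (hw : Measurable w) {C : ℝ} (hC : ∀ z, |w z| ≤ C) :
    ∫ z, w z ∂(Y.occupation s S) =
      ∫ ω, ∫ r in S, w (s, (r : D.Horizon), Y.path r ω) ∂D.clock ∂Y.P := by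
  rw [occupation, integral_map (Y.measurable_augPath s).aemeasurable hw.aestronglyMeasurable,
    integral_prod _ (Y.integrable_occupation hw hC)]
  rfl

/-- Dynkin's formula at the terminal time, in expectation. -/
theorem Follows.integral_dynkin_eq {Y : RandomPath D X} {L : Generator D X} {t : D.Time}
    (h : Y.Follows L t) (v : L.dom) :
    ∫ ω, Y.dynkin L v t ω ∂Y.P = ∫ ω, Y.dynkin L v D.zero ω ∂Y.P := by
  obtain ⟨ℱ, -, hmart⟩ := h
  have := (hmart v).setIntegral_eq (D.zero_le t) MeasurableSet.univ
  -- The cap `min · t` is inactive at both times compared, `0` and `t`.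
  simpa [min_eq_left (D.zero_le t)] using this.symm

theorem dynkin_zero (L : Generator D X) (v : L.dom) (ω : Y.Ω) :
    Y.dynkin L v D.zero ω =
      (v : C(D.Horizon × X, ℝ)) (D.zeroH, Y.path D.zero ω) := by
  have hempty : Set.Iio D.zero = ∅ :=
    Set.eq_empty_of_forall_notMem fun r hr => not_lt_of_ge (D.zero_le r) hr
  rw [dynkin, hempty]
  simp [TimeSetup.zero]

end RandomPath

/-! ### Feasibility and objective in the measure program -/

theorem measurable_diagMap : Measurable (diagMap D X) := by
  have : Measurable D.stopToHorizon := Measurable.subtype_mk measurable_subtype_coe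
  exact measurable_fst.prodMk ((this.comp measurable_fst).prodMk measurable_snd)

theorem measurable_initMap : Measurable (initMap D X) :=
  measurable_fst.prodMk (measurable_const.prodMk measurable_snd)

theorem TimeSetup.measurableSet_OmegaPlus : MeasurableSet D.OmegaPlus := by
  have h₁ : Measurable fun q : D.StopRange × D.Horizon => (q.1 : ℝ) := by fun_prop
  have h₂ : Measurable fun q : D.StopRange × D.Horizon => (q.2 : ℝ) := by fun_prop
  exact (measurableSet_le (h₁.sub_const _) h₂).inter (measurableSet_le h₂ h₁)

theorem TimeSetup.measurableSet_OmegaMinus : MeasurableSet D.OmegaMinus := by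
  have h₁ : Measurable fun q : D.StopRange × D.Horizon => (q.1 : ℝ) := by fun_prop
  have h₂ : Measurable fun q : D.StopRange × D.Horizon => (q.2 : ℝ) := by fun_prop
  exact measurableSet_le h₂ ((h₁.sub_const _).sub_const _)

/-- The initial, terminal and occupation measures of a process that starts at `x` and follows `L`
until `t` satisfy the flow equation of the augmented generator. -/
theorem RandomPath.Follows.integral_flow [CompactSpace X] {Y : RandomPath D X} {L : Generator D X}
    {t : D.Time} (hfollow : Y.Follows L t) {x : X} (hinit : ∀ᵐ ω ∂Y.P, Y.path D.zero ω = x)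
    {s : D.StopRange} (hs : D.stopToHorizon s = t)
    {v : C(D.StopRange × D.Horizon × X, ℝ)} {w : D.StopRange × D.Horizon × X → ℝ}
    (hvw : AugGraph L v w) :
    ∫ z, v z ∂((Y.P.map fun ω => (s, Y.path t ω)).map (diagMap D X)) =
      ∫ z, v z ∂((Measure.dirac (s, x)).map (initMap D X)) +
        ∫ z, w z ∂(Y.occupation s (Set.Iio t \ D.window t) + Y.occupation s (D.window t)) := by
  obtain ⟨hop, hw, C, hC⟩ := hvw
  -- All the measures sit over the single value `s`, so only this section of `v` enters.
  obtain ⟨hv, hop⟩ := hop s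
  have hterm : Measurable fun ω => (s, Y.path t ω) :=
    measurable_const.prodMk (Y.measurable_path_apply t)
  -- The flow sees only the sum of the two occupation measures, which is the occupation up to `t`.
  rw [Y.occupation_add_occupation_diff s (D.measurableSet_window t) (D.window_subset_Iio t),
    Y.integral_occupation hw hC,
    Measure.map_map measurable_diagMap hterm, Measure.map_dirac' measurable_initMap,
    integral_map (measurable_diagMap.comp hterm).aemeasurable
      v.continuous.measurable.aestronglyMeasurable,
    integral_dirac' _ _ v.continuous.measurable.stronglyMeasurable]
  have hdynkin := hfollow.integral_dynkin_eq ⟨timeSection v s, hv⟩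
  have hzero : ∫ ω, Y.dynkin L ⟨timeSection v s, hv⟩ D.zero ω ∂Y.P = v (initMap D X (s, x)) := by
    rw [integral_congr_ae (g := fun _ => v (initMap D X (s, x)))]
    · simp
    · filter_upwards [hinit] with ω hω
      rw [Y.dynkin_zero, hω]
      rfl
  -- Compactness of `X` bounds `v`, so the mean of `dynkin` splits into terminal and running parts.
  have hint_v : Integrable (fun ω => v (s, (t : D.Horizon), Y.path t ω)) Y.P :=
    Integrable.of_bound (v.continuous.measurable.comp (measurable_const.prodMk
      (measurable_const.prodMk (Y.measurable_path_apply t)))).aestronglyMeasurable ‖v‖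
      (Filter.Eventually.of_forall fun ω => v.norm_coe_le_norm _)
  have hint_w : Integrable
      (fun ω => ∫ r in Set.Iio t, w (s, (r : D.Horizon), Y.path r ω) ∂D.clock) Y.P :=
    (Y.integrable_occupation (s := s) (S := Set.Iio t) hw hC).integral_prod_left
  have hterminal : ∫ ω, Y.dynkin L ⟨timeSection v s, hv⟩ t ω ∂Y.P =
      ∫ ω, v (s, (t : D.Horizon), Y.path t ω) ∂Y.P -
        ∫ ω, ∫ r in Set.Iio t, w (s, (r : D.Horizon), Y.path r ω) ∂D.clock ∂Y.P := by
    rw [← integral_sub hint_v hint_w]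
    simp only [RandomPath.dynkin, hop]
    rfl
  simp only [Function.comp_apply, diagMap, hs]
  linarith

/-- The initial, terminal and occupation measures of a feasible trajectory are feasible for the
measure program. -/
theorem Feasible.lpFeasible {X₀ : Set (EuclideanSpace ℝ (Fin n))} (hX : IsCompact X)
    (hsub : X₀ ⊆ X) {L : Generator D X} {traj : X₀ → RandomPath D X} {t : D.Time} {x₀ : X₀}
    (hf : Feasible L traj t x₀) :
    LPFeasible X₀ L
      (Measure.dirac (D.toStopRange t hf.1, ⟨(x₀ : EuclideanSpace ℝ (Fin n)), hsub x₀.2⟩))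
      ((traj x₀).P.map fun ω => (D.toStopRange t hf.1, (traj x₀).path t ω))
      ((traj x₀).occupation (D.toStopRange t hf.1) (D.window t))
      ((traj x₀).occupation (D.toStopRange t hf.1) (Set.Iio t \ D.window t)) := by
  have := isCompact_iff_compactSpace.1 hX
  obtain ⟨ht, hinit, hfollow⟩ := hf
  refine ⟨inferInstance, inferInstance, inferInstance, inferInstance, ?_, ?_, ?_, ?_, ?_, ?_⟩
  · simp [Measure.dirac_apply]
  · exact (traj x₀).occupation_null_of_forall_mem _ (D.measurableSet_window t)
      D.measurableSet_OmegaPlus fun r hr => D.mem_OmegaPlus_of_mem_window ht hr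
  · exact (traj x₀).occupation_null_of_forall_mem _
      ((D.measurableSet_Iio_time t).diff (D.measurableSet_window t))
      D.measurableSet_OmegaMinus fun r hr => D.mem_OmegaMinus_of_mem_diff ht hr
  · exact fun v w hvw => hfollow.integral_flow (hinit.mono fun ω hω => Subtype.ext hω) rfl hvw
  · simp
  · rw [(traj x₀).occupation_univ, D.clock_window t ht]

/-- The objective of the measure program at the occupation measure of a window is the expected
window average. -/
theorem RandomPath.integral_occupation_window_div (hX : IsCompact X) (Y : RandomPath D X)
    (p : C(X, ℝ)) (s : D.StopRange) (t : D.Time) :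
    (∫ z, p z.2.2 ∂(Y.occupation s (D.window t))) / D.h =
      ∫ ω, Y.windowAverage p t ω ∂Y.P := by
  have := isCompact_iff_compactSpace.1 hX
  have hp : Measurable fun z : D.StopRange × D.Horizon × X => p z.2.2 :=
    p.continuous.measurable.comp (measurable_snd.comp measurable_snd)
  rw [Y.integral_occupation hp (C := ‖p‖) fun z => p.norm_coe_le_norm _]
  simp only [RandomPath.windowAverage]
  rw [integral_const_mul, one_div, div_eq_inv_mul]

end WindowRisk

theorem mainTheorem6 {n : ℕ} (D : WindowRisk.TimeSetup)
    (X X₀ : Set (EuclideanSpace ℝ (Fin n))) (hX : IsCompact X) (hX₀ : IsCompact X₀)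
    (hsub : X₀ ⊆ X) (p : C(X, ℝ)) (L : WindowRisk.Generator D X)
    (traj : X₀ → WindowRisk.RandomPath D X) (hA3 : ∀ x₀, (traj x₀).StopsAtExit) :
    WindowRisk.windowRiskValue WindowRisk.meanRisk L traj p ≤
      WindowRisk.meanLPValue X₀ L p := by
  refine sSup_le ?_
  rintro _ ⟨t, x₀, hf, rfl⟩
  -- The four measures are read off from `lpFeasible`; only equality of the objectives remains.
  refine le_sSup ⟨_, _, _, _, hf.lpFeasible hX hsub, ?_⟩
  rw [(traj x₀).integral_occupation_window_div hX p]
  rfl
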